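/- Let $D$ be a natural number, let $\mathcal X\subset\mathbb R^D$ be compact, and let $p:\mathbb R^D\to\mathbb R$ be a probability density (with respect to Lebesgue measure) that vanishes outside $\mathcal X$, is continuous on $\mathcal X$, and satisfies $p(x)\ge\delta$ for all $x\in\mathcal X$, for some constant $\delta>0$. Let $\Phi$ be the cumulative distribution function of $\mathcal N(0,1)$ and $\sigma(t)=1/(1+e^{-t})$ the sigmoid function. A *marginal Gaussianization layer* is a map $\Psi:\mathbb R^D\to\mathbb R^D$ of the form $$\Psi_i(\mathbf x)=\Phi^{-1}\Bigl(\frac1{N_i}\sum_{j=1}^{N_i}\sigma\Bigl(\frac{x_i-\mu_{ij}}{\sigma_{ij}}\Bigr)\Bigr),\qquad i=1,\dots,D,$$ with integers $N_i\ge1$, real anchor points $\mu_{ij}$ and bandwidths $\sigma_{ij}>0$. Then there exist a sequence of marginal Gaussianization layers $\Psi^{(1)},\Psi^{(2)},\dots$ and a sequence of rotation matrices $R^{(1)},R^{(2)},\dots$ (real orthogonal $D\times D$ matrices of determinant $1$), depending only on $D$ and $p$, such that for every random vector $\mathbf X\sim p$, $$\Psi^{(k)}\bigl(R^{(k)}\,\Psi^{(k-1)}\bigl(R^{(k-1)}\cdots\Psi^{(1)}(R^{(1)}\mathbf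 X)\bigr)\bigr)\ \xrightarrow{\ d\ }\ \mathcal N(\mathbf 0,\mathbf I)\qquad(k\to\infty).$$ -/

import Mathlib

open MeasureTheory ProbabilityTheory Filter

noncomputable section

namespace GaussianizationFlow

/-- The cumulative distribution function `Φ` of the standard normal distribution on `ℝ`. -/
def stdNormalCDF (x : ℝ) : ℝ := cdf (gaussianReal 0 1) x

/-- The inverse `Φ⁻¹ : (0, 1) → ℝ`. Since `Φ` is a bijection from `ℝ` onto `(0, 1)`, for
`u ∈ (0, 1)` this is the only `x` with `Φ x = u`. It is only ever applied to points of `(0, 1)`. -/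
def stdNormalCDFInv : ℝ → ℝ := Function.invFun stdNormalCDF

/-- The parameters of a marginal Gaussianization layer on `ℝ^D`: for each coordinate `i`, a positive
number `N i` of anchor points `μ i j ∈ ℝ`, with bandwidths `σ i j > 0`. -/
structure LayerParams (D : ℕ) where
  N : Fin D → ℕ
  N_pos : ∀ i, 0 < N i
  μ : (i : Fin D) → Fin (N i) → ℝ
  σ : (i : Fin D) → Fin (N i) → ℝ
  σ_pos : ∀ i j, 0 < σ i j

/-- The CDF of the equal-weight mixture of logistic distributions attached to coordinate `i`. -/
def LayerParams.mixtureCDF {D : ℕ} (θ : LayerParams D) (i : Fin D) (t : ℝ) : ℝ :=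
  (1 / (θ.N i : ℝ)) * ∑ j : Fin (θ.N i), Real.sigmoid ((t - θ.μ i j) / θ.σ i j)

/-- The marginal Gaussianization layer `Ψ_θ`: `Φ⁻¹` composed with a logistic-mixture CDF in each
coordinate. -/
def LayerParams.layer {D : ℕ} (θ : LayerParams D) (x : EuclideanSpace ℝ (Fin D)) :
    EuclideanSpace ℝ (Fin D) :=
  WithLp.toLp 2 fun i => stdNormalCDFInv (θ.mixtureCDF i (x i))

/-- The action of a rotation matrix on `ℝ^D`. -/
def rotate {D : ℕ} (R : Matrix.specialOrthogonalGroup (Fin D) ℝ) (x : EuclideanSpace ℝ (Fin D)) :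
    EuclideanSpace ℝ (Fin D) :=
  WithLp.toLp 2 (Matrix.mulVec (R : Matrix (Fin D) (Fin D) ℝ) x.ofLp)

/-- The Gaussianization flow made of the first `k` rotations and layers (numbered from `0`):
`Ψ_{k-1} ∘ R_{k-1} ∘ ⋯ ∘ Ψ_0 ∘ R_0`. -/
def flow {D : ℕ} (θ : ℕ → LayerParams D) (R : ℕ → Matrix.specialOrthogonalGroup (Fin D) ℝ) :
    ℕ → EuclideanSpace ℝ (Fin D) → EuclideanSpace ℝ (Fin D)
  | 0, x => x
  | k + 1, x => (θ k).layer (rotate (R k) (flow θ R k x))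

end GaussianizationFlow

end

/-! The flow is greedy, and log-likelihood is its Lyapunov function. Let `Q` be the law with density
`p` and γ the standard Gaussian. A layer sends the product of its logistic mixtures to γ, and
rotations preserve γ, so each flow `F` pushes some measure `exp L` · γ to γ (`IsGaussianTransport`).
One more rotation and layer adds `logGain` to `L`. Since `p` is bounded with compact support, `Q ≤ M
• γ`; hence ∫ L dQ ≤ ∫ exp L dQ ≤ M ∫ exp L dγ = M for every flow. If each step nearly maximizes the
mean gain, the gains have bounded partial sums and are nonnegative up to `(1/2)^k`, so the best
available gain tends to 0 (`exists_tendsto_zero_meanGain_le`).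

Vanishing gain forces Gaussian marginals. Let φ be the standard normal density and `h` bounded and
continuous with Gaussian mean 0. A layer whose mixture in coordinate `i` is close to φ(1 + t h), and
close to φ elsewhere, gains about t ∫ h((R F x)_i) dQ − O(t²), so these integrals become at most any
ε > 0. Using both signs of `h`, every coordinate of every rotated flow converges weakly to N(0,1).
Every direction is a coordinate after some rotation, so characteristic functions converge, and
Lévy's theorem concludes.

A lower bound on the gain only requires mixtures that dominate (1 − ε) φ(1 + t h) pointwise. This
one-sided approximation, tails included, is `dominatedByMixture_perturbation`. -/

noncomputable section

namespace GaussianizationFlow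

/-! ### Logistic densities and kernels -/

/-- The density of the standard logistic distribution. -/
def logisticPDF (s : ℝ) : ℝ := Real.sigmoid s * (1 - Real.sigmoid s)

lemma logisticPDF_pos (s : ℝ) : 0 < logisticPDF s :=
  mul_pos (Real.sigmoid_pos s) (sub_pos.2 (Real.sigmoid_lt_one s))

lemma continuous_logisticPDF : Continuous logisticPDF := by
  unfold logisticPDF
  exact continuous_sigmoid.mul (continuous_const.sub continuous_sigmoid)

/-- `exp (-u) * sigmoid u = 1 / (1 + exp u)` decreases in `u`. -/
lemma exp_mul_sigmoid_le {s t : ℝ} (h : s ≤ t) :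
    Real.exp (s - t) * Real.sigmoid t ≤ Real.sigmoid s := by
  have e : Real.exp (s - t) * (1 + Real.exp (-s)) = Real.exp (s - t) + Real.exp (-t) := by
    rw [mul_add, mul_one, ← Real.exp_add]; ring_nf
  have hle : Real.exp (s - t) ≤ 1 := Real.exp_le_one_iff.2 (by linarith)
  rw [Real.sigmoid_def, Real.sigmoid_def, ← div_eq_mul_inv, div_le_iff₀ (by positivity),
    ← div_eq_inv_mul, le_div_iff₀ (by positivity), e]
  linarith

/-- The logarithm of the logistic density is `1`-Lipschitz. -/
lemma exp_neg_abs_mul_logisticPDF_le (s t : ℝ) :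
    Real.exp (-|s - t|) * logisticPDF t ≤ logisticPDF s := by
  -- Of the factors σ and 1 − σ, one is monotone in the useful direction and the other absorbs the
  -- exponential, whence Lipschitz constant 1.
  have key : ∀ {s t : ℝ}, s ≤ t → Real.exp (s - t) * logisticPDF t ≤ logisticPDF s ∧
      Real.exp (s - t) * logisticPDF s ≤ logisticPDF t := by
    intro s t h
    have h1 := exp_mul_sigmoid_le h
    have h2 := exp_mul_sigmoid_le (neg_le_neg h)
    have h3 := Real.sigmoid_le h
    rw [Real.sigmoid_neg, Real.sigmoid_neg, show -t - -s = s - t by ring] at h2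
    have a1 := Real.sigmoid_pos s
    have a2 := Real.sigmoid_pos t
    have b1 := Real.sigmoid_lt_one s
    have b2 := Real.sigmoid_lt_one t
    unfold logisticPDF
    constructor
    · rw [← mul_assoc]
      exact mul_le_mul h1 (by linarith) (by linarith) a1.le
    · rw [mul_left_comm]
      exact mul_le_mul h3 h2 (mul_nonneg (Real.exp_pos _).le (by linarith)) a2.le
  rcases le_total s t with h | h
  · rw [abs_of_nonpos (by linarith), neg_neg]; exact (key h).1
  · rw [abs_of_nonneg (by linarith), neg_sub]; exact (key h).2

/-- Logistic tails are only exponentially small, so they will dominate Gaussian ones. -/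
lemma exp_neg_abs_div_le_logisticPDF (s : ℝ) : Real.exp (-|s|) / 4 ≤ logisticPDF s := by
  have h := exp_neg_abs_mul_logisticPDF_le s 0
  have h0 : logisticPDF 0 = 1 / 4 := by norm_num [logisticPDF, Real.sigmoid_zero]
  rw [sub_zero, h0] at h
  linarith

/-- The density at `x` of the logistic distribution with location `m` and scale `s`. -/
def logisticKernel (m s x : ℝ) : ℝ := 1 / s * logisticPDF ((x - m) / s)

lemma logisticKernel_pos {s : ℝ} (hs : 0 < s) (m x : ℝ) : 0 < logisticKernel m s x :=
  mul_pos (by positivity) (logisticPDF_pos _)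

lemma continuous_logisticKernel (m s : ℝ) : Continuous (logisticKernel m s) := by
  unfold logisticKernel
  have := continuous_logisticPDF
  fun_prop

lemma continuous_logisticKernel_left (s x : ℝ) : Continuous fun m => logisticKernel m s x := by
  unfold logisticKernel
  have := continuous_logisticPDF
  fun_prop

/-- The cost of moving the location is uniform in `x`, so a Riemann sum can dominate a convolution
on the whole line. -/
lemma logisticKernel_le_exp_mul {s : ℝ} (hs : 0 < s) (m m' x : ℝ) :
    Real.exp (-(|m - m'| / s)) * logisticKernel m s x ≤ logisticKernel m' s x := by
  have h := exp_neg_abs_mul_logisticPDF_le ((x - m') / s) ((x - m) / s)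
  rw [← sub_div, show x - m' - (x - m) = m - m' by ring, abs_div, abs_of_pos hs] at h
  unfold logisticKernel
  rw [mul_left_comm]
  exact mul_le_mul_of_nonneg_left h (by positivity)

lemma hasDerivAt_sigmoid_affine (m s x : ℝ) :
    HasDerivAt (fun x => Real.sigmoid ((x - m) / s)) (logisticKernel m s x) x := by
  have h1 : HasDerivAt (fun x : ℝ => (x - m) / s) (1 / s) x :=
    ((hasDerivAt_id x).sub_const m).div_const s
  have := (Real.hasDerivAt_sigmoid ((x - m) / s)).comp x h1
  rw [mul_comm] at this
  exact this

/-- For `r > 0` this mass tends to 1 as `s → 0⁺`: the kernels form an approximate identity. -/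
lemma integral_logisticKernel_left (s x r : ℝ) :
    ∫ y in (x - r)..(x + r), logisticKernel y s x =
      Real.sigmoid (r / s) - Real.sigmoid (-(r / s)) := by
  have hd : ∀ y ∈ Set.uIcc (x - r) (x + r),
      HasDerivAt (fun y => -Real.sigmoid ((x - y) / s)) (logisticKernel y s x) y := by
    intro y _
    have h1 : HasDerivAt (fun y : ℝ => (x - y) / s) (-1 / s) y :=
      ((hasDerivAt_id y).const_sub x).div_const s
    have := ((Real.hasDerivAt_sigmoid ((x - y) / s)).comp y h1).neg
    refine this.congr_deriv ?_
    rw [logisticKernel, logisticPDF]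
    ring
  rw [intervalIntegral.integral_eq_sub_of_hasDerivAt hd
    ((continuous_logisticKernel_left s x).intervalIntegrable _ _)]
  rw [show x - (x + r) = -r by ring, show x - (x - r) = r by ring, neg_div]
  ring

/-! ### Domination by equal-weight logistic mixtures -/

/-- An equal-weight logistic mixture indexed by `Fin N` for some `N`, dominating `f`. -/
def DominatedByMixture (f : ℝ → ℝ) : Prop :=
  ∃ (N : ℕ) (m s : Fin N → ℝ), 0 < N ∧ (∀ j, 0 < s j) ∧
    ∀ x, f x ≤ (1 / (N : ℝ)) * ∑ j, logisticKernel (m j) (s j) x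

lemma dominatedByMixture_of_fintype {κ : Type} [Fintype κ] {f : ℝ → ℝ} (m s : κ → ℝ)
    (hκ : 0 < Fintype.card κ) (hs : ∀ j, 0 < s j)
    (h : ∀ x, f x ≤ (1 / (Fintype.card κ : ℝ)) * ∑ j, logisticKernel (m j) (s j) x) :
    DominatedByMixture f := by
  let e := (Fintype.equivFin κ).symm
  refine ⟨Fintype.card κ, m ∘ e, s ∘ e, hκ, fun j => hs _, fun x => (h x).trans_eq ?_⟩
  congr 1
  exact (e.sum_comp fun j => logisticKernel (m j) (s j) x).symm

/-- Weights are rounded down: component `i` is repeated `⌊w i * N⌋₊` times among `N` anchors, and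
the leftover anchors all carry the kernel `(0, 1)`. For large `N` rounding costs at most the factor
`1 - ε`. -/
lemma dominatedByMixture_weighted {ι : Type} [Fintype ι] (w m s : ι → ℝ) (hw : ∀ i, 0 ≤ w i)
    (hs : ∀ i, 0 < s i) (hw1 : ∑ i, w i ≤ 1) {ε : ℝ} (hε : 0 < ε) :
    DominatedByMixture fun x => (1 - ε) * ∑ i, w i * logisticKernel (m i) (s i) x +
      (1 - ∑ i, w i) * logisticKernel 0 1 x := by
  have hN : ∀ i, ∀ᶠ N : ℕ in atTop, (1 - ε) * (w i * N) ≤ (⌊w i * N⌋₊ : ℝ) := by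
    intro i
    rcases (hw i).eq_or_lt with h0 | h0
    · simp [← h0]
    · have := ((tendsto_nat_floor_mul_div_atTop (hw i)).comp
        (tendsto_natCast_atTop_atTop (R := ℝ))).eventually_const_lt
          (show (1 - ε) * w i < w i by nlinarith)
      filter_upwards [this, eventually_gt_atTop 0] with N h1 h2
      have h2' : (0 : ℝ) < N := by exact_mod_cast h2
      rw [Function.comp_apply, lt_div_iff₀ h2'] at h1
      linarith
  obtain ⟨N, hN, hN0⟩ := ((eventually_all.2 hN).and (eventually_gt_atTop 0)).exists
  have hN0' : (0 : ℝ) < N := by exact_mod_cast hN0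
  set n : ι → ℕ := fun i => ⌊w i * N⌋₊ with hn
  have hle : ∀ i, (n i : ℝ) ≤ w i * N := fun i =>
    Nat.floor_le (mul_nonneg (hw i) hN0'.le)
  have hsum : (∑ i, (n i : ℝ)) ≤ (∑ i, w i) * N := by
    rw [Finset.sum_mul]; exact Finset.sum_le_sum fun i _ => hle i
  have hsumN : ∑ i, n i ≤ N := by
    have : ((∑ i, n i : ℕ) : ℝ) ≤ N := by
      push_cast
      exact hsum.trans (mul_le_of_le_one_left hN0'.le hw1)
    exact_mod_cast this
  have hcard : Fintype.card ((Σ i, Fin (n i)) ⊕ Fin (N - ∑ i, n i)) = N := by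
    simp only [Fintype.card_sum, Fintype.card_sigma, Fintype.card_fin]
    omega
  refine dominatedByMixture_of_fintype
    (Sum.elim (fun j : Σ i, Fin (n i) => m j.1) fun _ : Fin (N - ∑ i, n i) => 0)
    (Sum.elim (fun j => s j.1) fun _ => 1) (by rw [hcard]; exact hN0) ?_ ?_
  · rintro (j | j)
    · exact hs _
    · exact one_pos
  · intro x
    rw [hcard, Fintype.sum_sum_type, Fintype.sum_sigma]
    simp only [Sum.elim_inl, Sum.elim_inr, Finset.sum_const, Finset.card_univ, Fintype.card_fin,
      nsmul_eq_mul]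
    rw [Nat.cast_sub hsumN, one_div, ← div_eq_inv_mul, le_div_iff₀ hN0']
    push_cast
    have h1 : (1 - ε) * (∑ i, w i * logisticKernel (m i) (s i) x) * N ≤
        ∑ i, (n i : ℝ) * logisticKernel (m i) (s i) x := by
      rw [Finset.mul_sum, Finset.sum_mul]
      refine Finset.sum_le_sum fun i _ => ?_
      have := mul_le_mul_of_nonneg_right (hN i) (logisticKernel_pos (hs i) (m i) x).le
      linarith
    have h2 := mul_le_mul_of_nonneg_right hsum (logisticKernel_pos one_pos 0 x).le
    linarith

lemma DominatedByMixture.mono {f g : ℝ → ℝ} (hg : DominatedByMixture g) (h : ∀ x, f x ≤ g x) :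
    DominatedByMixture f := by
  obtain ⟨N, m, s, hN, hs, hd⟩ := hg
  exact ⟨N, m, s, hN, hs, fun x => (h x).trans (hd x)⟩

/-- Cut `[-B, B]` into `n` cells and move the mass of `f` in each to its left end. One factor `1 -
ε` pays for this move, the other for rounding the weights; the weight `η` is reserved for a kernel
covering the tails. -/
lemma dominatedByMixture_convolution {f : ℝ → ℝ} (hf : Continuous f) (hf0 : ∀ x, 0 ≤ f x)
    (hfi : Integrable f) (hf1 : ∫ x, f x ≤ 1) {B s η ε : ℝ} (hB : 0 < B) (hs : 0 < s)
    (hη0 : 0 ≤ η) (hη : η ≤ 1) (hε : 0 < ε) (hε1 : ε < 1) :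
    DominatedByMixture fun x => (1 - ε) * ((1 - ε) * ((1 - η) *
      ∫ y in (-B)..B, f y * logisticKernel y s x)) + η * logisticKernel 0 1 x := by
  have hlim : Tendsto (fun n : ℕ => Real.exp (-((2 * B / n) / s))) atTop (nhds 1) := by
    have h1 := ((tendsto_const_div_atTop_nhds_zero_nat (2 * B)).div_const s).neg
    have := (Real.continuous_exp.tendsto _).comp h1
    simpa [Function.comp_def] using this
  obtain ⟨n, hn, hn0⟩ := ((hlim.eventually_const_lt (show 1 - ε < 1 by linarith)).and
    (eventually_gt_atTop 0)).exists
  have hn0' : (0 : ℝ) < n := by exact_mod_cast hn0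
  set a : ℕ → ℝ := fun k => -B + k * (2 * B / n) with ha
  have ha0 : a 0 = -B := by simp [ha]
  have han : a n = B := by simp only [ha]; field_simp; ring
  have hstep : ∀ k, a (k + 1) = a k + 2 * B / n := by intro k; simp only [ha]; push_cast; ring
  have hδ : 0 < 2 * B / n := by positivity
  have hmono : ∀ k, a k ≤ a (k + 1) := fun k => by rw [hstep]; linarith
  have hsumI : ∀ g : ℝ → ℝ, Continuous g →
      ∑ k : Fin n, ∫ y in (a k)..(a (k + 1)), g y = ∫ y in (-B)..B, g y := by
    intro g hg
    rw [Fin.sum_univ_eq_sum_range (fun k => ∫ y in (a k)..(a (k + 1)), g y) n,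
      intervalIntegral.sum_integral_adjacent_intervals fun k _ => hg.intervalIntegrable _ _,
      ha0, han]
  set w : Fin n → ℝ := fun k => (1 - η) * ∫ y in (a k)..(a (k + 1)), f y with hw
  have hIf : ∫ y in (-B)..B, f y ≤ 1 := by
    rw [intervalIntegral.integral_of_le (by linarith)]
    exact (setIntegral_le_integral hfi (ae_of_all _ hf0)).trans hf1
  have hw0 : ∀ k, 0 ≤ w k := fun k => mul_nonneg (by linarith)
    (intervalIntegral.integral_nonneg (hmono k) fun y _ => hf0 y)
  have hwsum : ∑ k, w k ≤ 1 - η := by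
    rw [hw, ← Finset.mul_sum, hsumI f hf]
    exact mul_le_of_le_one_right (by linarith) hIf
  refine (dominatedByMixture_weighted w (fun k => a k) (fun _ => s) hw0 (fun _ => hs)
    (by linarith) hε).mono fun x => ?_
  have hk0 := (logisticKernel_pos one_pos 0 x).le
  refine add_le_add (mul_le_mul_of_nonneg_left ?_ (by linarith))
    (mul_le_mul_of_nonneg_right (by linarith) hk0)
  have hc : Continuous fun y => f y * logisticKernel y s x :=
    hf.mul (continuous_logisticKernel_left s x)
  rw [← hsumI _ hc, Finset.mul_sum, Finset.mul_sum]
  refine Finset.sum_le_sum fun k _ => ?_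
  rw [hw, mul_left_comm, mul_assoc]
  refine mul_le_mul_of_nonneg_left ?_ (by linarith)
  rw [← intervalIntegral.integral_const_mul, ← intervalIntegral.integral_mul_const]
  refine intervalIntegral.integral_mono_on (hmono k) ((hc.const_mul _).intervalIntegrable _ _)
    ((hf.mul_const _).intervalIntegrable _ _) fun y hy => ?_
  rw [mul_left_comm]
  refine mul_le_mul_of_nonneg_left ?_ (hf0 y)
  refine le_trans ?_ (logisticKernel_le_exp_mul hs y (a k) x)
  refine mul_le_mul_of_nonneg_right (hn.le.trans ?_) (logisticKernel_pos hs y x).le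
  rw [Real.exp_le_exp, neg_le_neg_iff]
  gcongr
  rw [abs_of_nonneg (by linarith [hy.1])]
  linarith [hy.2, hstep k]

/-- Equal-weight logistic mixtures dominate every continuous positive density with light tails, up
to a factor arbitrarily close to `1`. -/
theorem dominatedByMixture_of_continuous {f : ℝ → ℝ} (hf : Continuous f) (hf0 : ∀ x, 0 < f x)
    (hfi : Integrable f) (hf1 : ∫ x, f x ≤ 1)
    (htail : ∀ η > 0, ∃ A, ∀ x, A ≤ |x| → f x ≤ η * logisticKernel 0 1 x)
    {ε : ℝ} (hε : 0 < ε) (hε1 : ε < 1) : DominatedByMixture fun x => (1 - ε) * f x := by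
  -- Five losses of `1 - q` occur: rounding, discretization, the reserved tail weight, the
  -- oscillation of `f`, and the kernel mass beyond `r`. Bernoulli gives `(1 - q)^5 ≥ 1 - 5q`.
  set q := ε / 5 with hq
  have hq0 : 0 < q := by positivity
  have hq1 : q < 1 := by linarith
  obtain ⟨A', hA'⟩ := htail q hq0
  set A := max A' 0 with hA
  have hA0 : 0 ≤ A := le_max_right _ _
  -- The extra 1 leaves room for a radius `r ≤ 1`; the lower bound `c` turns an oscillation of `q *
  -- c` into the relative factor `1 - q`.
  obtain ⟨c, hc0, hc⟩ : ∃ c > 0, ∀ x ∈ Set.Icc (-(A + 1)) (A + 1), c ≤ f x := by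
    obtain ⟨z, -, hz⟩ := isCompact_Icc.exists_isMinOn
      (Set.nonempty_Icc.2 (by linarith : -(A + 1) ≤ A + 1)) hf.continuousOn
    exact ⟨f z, hf0 z, fun x hx => hz hx⟩
  obtain ⟨r, hr0, hr1, hr⟩ : ∃ r > 0, r ≤ 1 ∧ ∀ x y, |x| ≤ A → |y - x| ≤ r →
      (1 - q) * f x ≤ f y := by
    have hu := (isCompact_Icc (a := -(A + 1)) (b := A + 1)).uniformContinuousOn_of_continuous
      hf.continuousOn
    rw [Metric.uniformContinuousOn_iff] at hu
    obtain ⟨d, hd0, hd⟩ := hu (q * c) (by positivity)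
    refine ⟨min (d / 2) 1, by positivity, min_le_right _ _, fun x y hx hy => ?_⟩
    have hy1 : |y - x| ≤ 1 := hy.trans (min_le_right _ _)
    have hy2 : |y - x| ≤ d / 2 := hy.trans (min_le_left _ _)
    rw [abs_le] at hx hy1
    have hxm : x ∈ Set.Icc (-(A + 1)) (A + 1) := ⟨by linarith, by linarith⟩
    have hym : y ∈ Set.Icc (-(A + 1)) (A + 1) := ⟨by linarith, by linarith⟩
    have := hd y hym x hxm (by rw [Real.dist_eq]; linarith)
    rw [Real.dist_eq] at this
    have h2 := (abs_lt.1 this).1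
    have h3 := mul_le_mul_of_nonneg_left (hc x hxm) hq0.le
    linarith
  obtain ⟨s, hs0, hs⟩ : ∃ s > 0, 1 - q ≤ Real.sigmoid (r / s) - Real.sigmoid (-(r / s)) := by
    have h1 : Tendsto (fun u => Real.sigmoid u - Real.sigmoid (-u)) atTop (nhds (1 - 0)) :=
      Real.tendsto_sigmoid_atTop.sub (Real.tendsto_sigmoid_atBot.comp tendsto_neg_atTop_atBot)
    obtain ⟨u, hu, hu0⟩ := ((h1.eventually_const_lt
      (show 1 - q < 1 - 0 by linarith)).and (eventually_gt_atTop 0)).exists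
    refine ⟨r / u, by positivity, ?_⟩
    rw [div_div_cancel₀ hr0.ne']
    exact hu.le
  refine (dominatedByMixture_convolution hf (fun x => (hf0 x).le) hfi hf1
    (by linarith : 0 < A + 1) hs0 hq0.le hq1.le hq0 hq1).mono fun x => ?_
  have hcont : Continuous fun y => f y * logisticKernel y s x :=
    hf.mul (continuous_logisticKernel_left s x)
  have hpos : ∀ y, 0 ≤ f y * logisticKernel y s x := fun y =>
    mul_nonneg (hf0 y).le (logisticKernel_pos hs0 y x).le
  have hI0 : 0 ≤ ∫ y in (-(A + 1))..(A + 1), f y * logisticKernel y s x :=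
    intervalIntegral.integral_nonneg (by linarith) fun y _ => hpos y
  have hk0 := (logisticKernel_pos one_pos 0 x).le
  have hfx := (hf0 x).le
  -- In the tail the reserved kernel alone suffices; in the bulk the convolution does.
  rcases le_or_gt A |x| with hx | hx
  · have h1 := hA' x ((le_max_left _ _).trans hx)
    have h2 : 0 ≤ (1 - q) * ((1 - q) * ((1 - q) *
        ∫ y in (-(A + 1))..(A + 1), f y * logisticKernel y s x)) := by
      have : 0 ≤ 1 - q := by linarith
      positivity
    have h3 : (1 - ε) * f x ≤ f x := by nlinarith
    linarith
  · have hI : (1 - q) * ((1 - q) * f x) ≤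
        ∫ y in (-(A + 1))..(A + 1), f y * logisticKernel y s x := by
      have hx' := abs_lt.1 hx
      calc (1 - q) * ((1 - q) * f x)
          ≤ (Real.sigmoid (r / s) - Real.sigmoid (-(r / s))) * ((1 - q) * f x) :=
            mul_le_mul_of_nonneg_right hs (mul_nonneg (by linarith) hfx)
        _ = ∫ y in (x - r)..(x + r), ((1 - q) * f x) * logisticKernel y s x := by
            rw [intervalIntegral.integral_const_mul, integral_logisticKernel_left, mul_comm]
        _ ≤ ∫ y in (x - r)..(x + r), f y * logisticKernel y s x := by
            refine intervalIntegral.integral_mono_on (by linarith)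
              (((continuous_logisticKernel_left s x).const_mul _).intervalIntegrable _ _)
              (hcont.intervalIntegrable _ _) fun y hy => ?_
            refine mul_le_mul_of_nonneg_right (hr x y hx.le ?_) (logisticKernel_pos hs0 y x).le
            rw [abs_le]; constructor <;> linarith [hy.1, hy.2]
        _ ≤ _ := by
            refine intervalIntegral.integral_mono_interval (by linarith) (by linarith)
              (by linarith) (ae_of_all _ hpos) (hcont.intervalIntegrable _ _)
    have h1q : 0 ≤ 1 - q := by linarith
    have h4 : 1 - 5 * q ≤ (1 - q) * ((1 - q) * ((1 - q) * ((1 - q) * (1 - q)))) := by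
      have := one_add_mul_le_pow (show -2 ≤ -q by linarith) 5
      norm_num at this
      nlinarith [this]
    calc (1 - ε) * f x = (1 - 5 * q) * f x := by rw [hq]; ring
      _ ≤ (1 - q) * ((1 - q) * ((1 - q) * ((1 - q) * (1 - q)))) * f x :=
          mul_le_mul_of_nonneg_right h4 hfx
      _ = (1 - q) * ((1 - q) * ((1 - q) * ((1 - q) * ((1 - q) * f x)))) := by ring
      _ ≤ (1 - q) * ((1 - q) * ((1 - q) *
            ∫ y in (-(A + 1))..(A + 1), f y * logisticKernel y s x)) := by gcongr
      _ ≤ _ := le_add_of_nonneg_right (mul_nonneg hq0.le hk0)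

/-! ### The standard normal density, its perturbations, and its CDF -/

/-- The density of the standard normal distribution on `ℝ`. -/
abbrev stdNormalPDF : ℝ → ℝ := gaussianPDFReal 0 1

lemma stdNormalPDF_pos (x : ℝ) : 0 < stdNormalPDF x := gaussianPDFReal_pos 0 1 x one_ne_zero

lemma continuous_stdNormalPDF : Continuous stdNormalPDF := by
  unfold stdNormalPDF gaussianPDFReal
  fun_prop

lemma stdNormalPDF_le (x : ℝ) : stdNormalPDF x ≤ Real.exp (-x ^ 2 / 2) := by
  have h : 1 ≤ √(2 * Real.pi) := by
    rw [Real.one_le_sqrt]; linarith [Real.pi_gt_three]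
  simp only [stdNormalPDF, gaussianPDFReal, NNReal.coe_one, mul_one, sub_zero]
  exact mul_le_of_le_one_left (Real.exp_pos _).le (inv_le_one_of_one_le₀ h)

/-- Small bounded mean-zero relative perturbations of the standard normal density are dominated by
equal-weight logistic mixtures. -/
theorem dominatedByMixture_perturbation {h : ℝ → ℝ} (hc : Continuous h)
    (hb : ∀ x, |h x| ≤ 1 / 2) (h0 : ∫ x, h x ∂(gaussianReal 0 1) = 0) {ε : ℝ} (hε : 0 < ε)
    (hε1 : ε < 1) : DominatedByMixture fun x => (1 - ε) * (stdNormalPDF x * (1 + h x)) := by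
  have hb' := fun x => abs_le.1 (hb x)
  have hφi : Integrable stdNormalPDF := integrable_gaussianPDFReal 0 1
  have hφh : Integrable fun x => stdNormalPDF x * h x :=
    hφi.mul_bdd (c := 1 / 2) hc.aestronglyMeasurable (ae_of_all _ hb)
  have heq : (fun x => stdNormalPDF x * (1 + h x)) =
      fun x => stdNormalPDF x + stdNormalPDF x * h x := by ext x; ring
  refine dominatedByMixture_of_continuous (f := fun x => stdNormalPDF x * (1 + h x))
    (continuous_stdNormalPDF.mul (hc.const_add 1))
    (fun x => mul_pos (stdNormalPDF_pos x) (by linarith [hb' x])) ?_ ?_ ?_ hε hε1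
  · rw [heq]; exact hφi.add hφh
  · rw [heq, integral_add hφi hφh]
    rw [integral_gaussianReal_eq_integral_smul one_ne_zero] at h0
    simp only [smul_eq_mul] at h0
    rw [h0, integral_gaussianPDFReal_eq_one 0 one_ne_zero, add_zero]
  · intro η hη
    -- `|x| ≥ 4` gives `x²/2 ≥ 2|x|`. The 8 is the bound 2 for `1 + h` times the 4 in the logistic
    -- tail bound.
    refine ⟨max 4 (Real.log (8 / η)), fun x hx => ?_⟩
    have h1 : 4 ≤ |x| := (le_max_left _ _).trans hx
    have h2 : Real.log (8 / η) ≤ |x| := (le_max_right _ _).trans hx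
    have h3 := exp_neg_abs_div_le_logisticPDF x
    have h4 : stdNormalPDF x ≤ Real.exp (-|x|) * Real.exp (-|x|) := by
      refine (stdNormalPDF_le x).trans ?_
      rw [← Real.exp_add, Real.exp_le_exp, ← sq_abs]
      nlinarith
    have h5 : Real.exp (-|x|) ≤ η / 8 := by
      rw [Real.exp_neg, ← inv_div, inv_le_inv₀ (Real.exp_pos _) (by positivity)]
      exact (Real.log_le_iff_le_exp (by positivity)).1 h2
    have h6 : logisticKernel 0 1 x = logisticPDF x := by simp [logisticKernel]
    rw [h6]
    have he := Real.exp_pos (-|x|)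
    calc stdNormalPDF x * (1 + h x) ≤ stdNormalPDF x * 2 :=
          mul_le_mul_of_nonneg_left (by linarith [hb' x]) (stdNormalPDF_pos x).le
      _ ≤ (η / 8 * Real.exp (-|x|)) * 2 := by nlinarith
      _ = η * (Real.exp (-|x|) / 4) := by ring
      _ ≤ η * logisticPDF x := mul_le_mul_of_nonneg_left h3 hη.le

lemma gaussianReal_eq_withDensity :
    gaussianReal 0 1 = volume.withDensity fun x => ENNReal.ofReal (stdNormalPDF x) :=
  gaussianReal_of_var_ne_zero 0 one_ne_zero

lemma stdNormalCDF_sub (a b : ℝ) :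
    stdNormalCDF b - stdNormalCDF a = ∫ x in a..b, stdNormalPDF x := by
  have key : ∀ c, stdNormalCDF c = ∫ x in Set.Iic c, stdNormalPDF x := by
    intro c
    rw [stdNormalCDF, cdf_eq_real, measureReal_def, gaussianReal_apply_eq_integral 0 one_ne_zero,
      ENNReal.toReal_ofReal]
    exact integral_nonneg fun x => (stdNormalPDF_pos x).le
  have hi : Integrable stdNormalPDF := integrable_gaussianPDFReal 0 1
  rw [key, key, intervalIntegral.integral_Iic_sub_Iic hi.integrableOn hi.integrableOn]

lemma strictMono_stdNormalCDF : StrictMono stdNormalCDF := by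
  intro a b hab
  rw [← sub_pos, stdNormalCDF_sub]
  exact intervalIntegral.intervalIntegral_pos_of_pos
    (continuous_stdNormalPDF.intervalIntegrable _ _) stdNormalPDF_pos hab

lemma continuous_stdNormalCDF : Continuous stdNormalCDF := by
  have : stdNormalCDF = fun b => stdNormalCDF 0 + ∫ x in (0 : ℝ)..b, stdNormalPDF x := by
    ext b; rw [← stdNormalCDF_sub]; ring
  rw [this]
  exact continuous_const.add (intervalIntegral.continuous_primitive
    (fun a b => continuous_stdNormalPDF.intervalIntegrable a b) 0)

lemma stdNormalCDF_mem_Ioo (x : ℝ) : stdNormalCDF x ∈ Set.Ioo 0 1 :=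
  ⟨(cdf_nonneg _ (x - 1)).trans_lt (strictMono_stdNormalCDF (by linarith)),
    (strictMono_stdNormalCDF (by linarith : x < x + 1)).trans_le (cdf_le_one _ _)⟩

lemma mem_range_of_tendsto_zero_one {G : ℝ → ℝ} (hG : Continuous G)
    (h0 : Tendsto G atBot (nhds 0)) (h1 : Tendsto G atTop (nhds 1)) {u : ℝ}
    (hu : u ∈ Set.Ioo 0 1) : u ∈ Set.range G := by
  obtain ⟨a, ha⟩ := (h0.eventually_lt_const hu.1).exists
  obtain ⟨b, hb⟩ := (h1.eventually_const_lt hu.2).exists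
  exact mem_range_of_exists_le_of_exists_ge hG ⟨a, ha.le⟩ ⟨b, hb.le⟩

lemma stdNormalCDF_stdNormalCDFInv {u : ℝ} (hu : u ∈ Set.Ioo 0 1) :
    stdNormalCDF (stdNormalCDFInv u) = u :=
  Function.invFun_eq (mem_range_of_tendsto_zero_one continuous_stdNormalCDF
    (tendsto_cdf_atBot _) (tendsto_cdf_atTop _) hu)

lemma stdNormalCDFInv_stdNormalCDF (x : ℝ) : stdNormalCDFInv (stdNormalCDF x) = x :=
  Function.leftInverse_invFun strictMono_stdNormalCDF.injective x

/-! ### A layer as a transport of logistic mixtures to the Gaussian -/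

namespace LayerParams

variable {D : ℕ} (θ : LayerParams D) (i : Fin D)

/-- The density of the logistic mixture attached to coordinate `i`. -/
def mixturePDF (t : ℝ) : ℝ :=
  (1 / (θ.N i : ℝ)) * ∑ j, logisticKernel (θ.μ i j) (θ.σ i j) t

lemma natCast_N_pos : (0 : ℝ) < θ.N i := by exact_mod_cast θ.N_pos i

lemma mixturePDF_pos (t : ℝ) : 0 < θ.mixturePDF i t := by
  have := θ.natCast_N_pos i
  have : Nonempty (Fin (θ.N i)) := ⟨⟨0, θ.N_pos i⟩⟩
  exact mul_pos (by positivity) (Finset.sum_pos (fun j _ => logisticKernel_pos (θ.σ_pos i j) _ _)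
    Finset.univ_nonempty)

lemma continuous_mixturePDF : Continuous (θ.mixturePDF i) :=
  continuous_const.mul (continuous_finsetSum _ fun _ _ => continuous_logisticKernel _ _)

lemma hasDerivAt_mixtureCDF (t : ℝ) : HasDerivAt (θ.mixtureCDF i) (θ.mixturePDF i t) t :=
  (HasDerivAt.fun_sum fun j _ => hasDerivAt_sigmoid_affine (θ.μ i j) (θ.σ i j) t).const_mul _

lemma continuous_mixtureCDF : Continuous (θ.mixtureCDF i) :=
  continuous_iff_continuousAt.2 fun t => (θ.hasDerivAt_mixtureCDF i t).continuousAt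

lemma strictMono_mixtureCDF : StrictMono (θ.mixtureCDF i) :=
  strictMono_of_hasDerivAt_pos (θ.hasDerivAt_mixtureCDF i) (θ.mixturePDF_pos i)

lemma tendsto_mixtureCDF_atBot : Tendsto (θ.mixtureCDF i) atBot (nhds 0) := by
  have h : ∀ j, Tendsto (fun t => Real.sigmoid ((t - θ.μ i j) / θ.σ i j)) atBot (nhds 0) :=
    fun j => Real.tendsto_sigmoid_atBot.comp
      ((tendsto_atBot_add_const_right _ (-θ.μ i j) tendsto_id).atBot_div_const (θ.σ_pos i j))
  have := (tendsto_finsetSum Finset.univ fun j _ => h j).const_mul (1 / (θ.N i : ℝ))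
  rw [Finset.sum_const_zero, mul_zero] at this
  exact this

lemma tendsto_mixtureCDF_atTop : Tendsto (θ.mixtureCDF i) atTop (nhds 1) := by
  have h : ∀ j, Tendsto (fun t => Real.sigmoid ((t - θ.μ i j) / θ.σ i j)) atTop (nhds 1) :=
    fun j => Real.tendsto_sigmoid_atTop.comp
      ((tendsto_atTop_add_const_right _ (-θ.μ i j) tendsto_id).atTop_div_const (θ.σ_pos i j))
  have := (tendsto_finsetSum Finset.univ fun j _ => h j).const_mul (1 / (θ.N i : ℝ))
  rw [Finset.sum_const, Finset.card_univ, Fintype.card_fin, nsmul_one, one_div,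
    inv_mul_cancel₀ (θ.natCast_N_pos i).ne', ← one_div] at this
  exact this

lemma mixtureCDF_mem_Ioo (t : ℝ) : θ.mixtureCDF i t ∈ Set.Ioo 0 1 :=
  ⟨((θ.strictMono_mixtureCDF i).monotone.le_of_tendsto (θ.tendsto_mixtureCDF_atBot i)
      (t - 1)).trans_lt (θ.strictMono_mixtureCDF i (by linarith)),
    (θ.strictMono_mixtureCDF i (by linarith : t < t + 1)).trans_le
      ((θ.strictMono_mixtureCDF i).monotone.ge_of_tendsto (θ.tendsto_mixtureCDF_atTop i) _)⟩

/-- The action of the layer on coordinate `i`. -/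
def coordMap (t : ℝ) : ℝ := stdNormalCDFInv (θ.mixtureCDF i t)

lemma stdNormalCDF_coordMap (t : ℝ) : stdNormalCDF (θ.coordMap i t) = θ.mixtureCDF i t :=
  stdNormalCDF_stdNormalCDFInv (θ.mixtureCDF_mem_Ioo i t)

lemma strictMono_coordMap : StrictMono (θ.coordMap i) := by
  intro a b hab
  rw [← strictMono_stdNormalCDF.lt_iff_lt, stdNormalCDF_coordMap, stdNormalCDF_coordMap]
  exact θ.strictMono_mixtureCDF i hab

lemma surjective_coordMap : Function.Surjective (θ.coordMap i) := by
  intro c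
  obtain ⟨x, hx⟩ := mem_range_of_tendsto_zero_one (θ.continuous_mixtureCDF i)
    (θ.tendsto_mixtureCDF_atBot i) (θ.tendsto_mixtureCDF_atTop i) (stdNormalCDF_mem_Ioo c)
  exact ⟨x, by rw [coordMap, hx, stdNormalCDFInv_stdNormalCDF]⟩

lemma continuous_coordMap : Continuous (θ.coordMap i) :=
  (θ.strictMono_coordMap i).monotone.continuous_of_surjective (θ.surjective_coordMap i)

lemma continuous_layer : Continuous θ.layer :=
  (PiLp.continuous_toLp 2 _).comp (continuous_pi fun i =>
    (θ.continuous_coordMap i).comp (PiLp.continuous_apply 2 _ i))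

/-- The ratio of the density of the logistic mixture to the standard normal density. -/
def densityRatio (t : ℝ) : ℝ := θ.mixturePDF i t / stdNormalPDF t

lemma densityRatio_pos (t : ℝ) : 0 < θ.densityRatio i t :=
  div_pos (θ.mixturePDF_pos i t) (stdNormalPDF_pos t)

lemma continuous_densityRatio : Continuous (θ.densityRatio i) :=
  (θ.continuous_mixturePDF i).div continuous_stdNormalPDF fun t => (stdNormalPDF_pos t).ne'

/-- The logistic mixture distribution attached to coordinate `i`. -/
def mixtureMeasure : Measure ℝ :=
  (gaussianReal 0 1).withDensity fun t => ENNReal.ofReal (θ.densityRatio i t)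

lemma mixtureMeasure_eq :
    θ.mixtureMeasure i = volume.withDensity fun t => ENNReal.ofReal (θ.mixturePDF i t) := by
  rw [mixtureMeasure, gaussianReal_eq_withDensity, ← withDensity_mul]
  · congr 1
    ext t
    rw [Pi.mul_apply, ← ENNReal.ofReal_mul (stdNormalPDF_pos t).le, densityRatio,
      mul_div_cancel₀ _ (stdNormalPDF_pos t).ne']
  · exact continuous_stdNormalPDF.measurable.ennreal_ofReal
  · exact (θ.continuous_densityRatio i).measurable.ennreal_ofReal

lemma mixtureMeasure_Iic (c : ℝ) :
    θ.mixtureMeasure i (Set.Iic c) = ENNReal.ofReal (θ.mixtureCDF i c) := by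
  have h1 : Tendsto (fun a => θ.mixtureMeasure i (Set.Ioc a c)) atBot
      (nhds (θ.mixtureMeasure i (Set.Iic c))) := tendsto_measure_Ioc_atBot _ _
  have h2 : Tendsto (fun a => ENNReal.ofReal (θ.mixtureCDF i c - θ.mixtureCDF i a)) atBot
      (nhds (ENNReal.ofReal (θ.mixtureCDF i c - 0))) :=
    ENNReal.tendsto_ofReal ((θ.tendsto_mixtureCDF_atBot i).const_sub _)
  rw [sub_zero] at h2
  refine tendsto_nhds_unique h1 (h2.congr' ?_)
  filter_upwards [eventually_le_atBot c] with a ha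
  rw [mixtureMeasure_eq, withDensity_apply _ measurableSet_Ioc,
    ← intervalIntegral.integral_eq_sub_of_hasDerivAt
      (fun x _ => θ.hasDerivAt_mixtureCDF i x)
      ((θ.continuous_mixturePDF i).intervalIntegrable a c),
    intervalIntegral.integral_of_le ha, ofReal_integral_eq_lintegral_ofReal]
  · exact ((θ.continuous_mixturePDF i).integrableOn_Icc).mono_set Set.Ioc_subset_Icc_self
  · exact ae_of_all _ fun x => (θ.mixturePDF_pos i x).le

instance : IsProbabilityMeasure (θ.mixtureMeasure i) where
  measure_univ := by
    have h1 : Tendsto (fun c => θ.mixtureMeasure i (Set.Iic c)) atTop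
        (nhds (θ.mixtureMeasure i Set.univ)) := tendsto_measure_Iic_atTop _
    simp_rw [mixtureMeasure_Iic] at h1
    refine tendsto_nhds_unique h1 ?_
    simpa using ENNReal.tendsto_ofReal (θ.tendsto_mixtureCDF_atTop i)

/-- Each coordinate of the layer Gaussianizes the corresponding logistic mixture. -/
lemma map_coordMap_mixtureMeasure :
    (θ.mixtureMeasure i).map (θ.coordMap i) = gaussianReal 0 1 := by
  have hm := (θ.continuous_coordMap i).measurable
  have := Measure.isProbabilityMeasure_map (μ := θ.mixtureMeasure i) hm.aemeasurable
  refine Measure.ext_of_Iic _ _ fun c => ?_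
  obtain ⟨x, rfl⟩ := θ.surjective_coordMap i c
  rw [Measure.map_apply hm measurableSet_Iic]
  have : θ.coordMap i ⁻¹' Set.Iic (θ.coordMap i x) = Set.Iic x := by
    ext y; exact (θ.strictMono_coordMap i).le_iff_le
  rw [this, mixtureMeasure_Iic, ← stdNormalCDF_coordMap, stdNormalCDF, ofReal_cdf]

/-- The logarithm of the density, relative to the standard Gaussian, of the product of the logistic
mixtures of a layer. -/
def logGain (z : EuclideanSpace ℝ (Fin D)) : ℝ := ∑ i, Real.log (θ.densityRatio i (z i))

lemma continuous_logGain : Continuous θ.logGain :=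
  continuous_finsetSum _ fun i _ =>
    ((θ.continuous_densityRatio i).comp (PiLp.continuous_apply 2 _ i)).log
      fun _ => (θ.densityRatio_pos i _).ne'

lemma exp_logGain (z : EuclideanSpace ℝ (Fin D)) :
    Real.exp (θ.logGain z) = ∏ i, θ.densityRatio i (z i) := by
  rw [logGain, Real.exp_sum]
  exact Finset.prod_congr rfl fun i _ => Real.exp_log (θ.densityRatio_pos i _)

end LayerParams

/-- On a box, the indicator times the density is a product of functions of independent coordinates,
so its integral factors. -/
lemma pi_withDensity {ι : Type*} [Fintype ι] {α : ι → Type*} [∀ i, MeasurableSpace (α i)]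
    (μ : ∀ i, Measure (α i)) [∀ i, IsProbabilityMeasure (μ i)] {f : ∀ i, α i → ENNReal}
    (hf : ∀ i, Measurable (f i)) [∀ i, SigmaFinite ((μ i).withDensity (f i))] :
    Measure.pi (fun i => (μ i).withDensity (f i)) =
      (Measure.pi μ).withDensity fun x => ∏ i, f i (x i) := by
  refine Measure.pi_eq fun s hs => ?_
  rw [withDensity_apply _ (MeasurableSet.univ_pi hs),
    ← lintegral_indicator (MeasurableSet.univ_pi hs)]
  have hm : ∀ i, Measurable ((s i).indicator (f i)) := fun i => (hf i).indicator (hs i)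
  have h1 : (Set.univ.pi s).indicator (fun x : ∀ i, α i => ∏ i, f i (x i)) =
      fun x => ∏ i, (s i).indicator (f i) (x i) := by
    ext x
    by_cases hx : x ∈ Set.univ.pi s
    · rw [Set.indicator_of_mem hx]
      exact Finset.prod_congr rfl fun i _ => (Set.indicator_of_mem (hx i trivial) _).symm
    · rw [Set.indicator_of_notMem hx]
      simp only [Set.mem_univ_pi, not_forall] at hx
      obtain ⟨i, hi⟩ := hx
      exact (Finset.prod_eq_zero (Finset.mem_univ i) (Set.indicator_of_notMem hi _)).symm
  rw [h1, lintegral_prod_eq_prod_lintegral_of_indepFun Finset.univ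
    (fun i (x : ∀ i, α i) => (s i).indicator (f i) (x i))
    (iIndepFun_pi fun i => (hm i).aemeasurable) fun i => (hm i).comp (measurable_pi_apply i)]
  refine Finset.prod_congr rfl fun i _ => ?_
  rw [withDensity_apply _ (hs i), ← lintegral_indicator (hs i)]
  exact (measurePreserving_eval μ i).lintegral_comp (hm i)

lemma lintegral_stdGaussian {D : ℕ} {f : EuclideanSpace ℝ (Fin D) → ENNReal} (hf : Measurable f) :
    ∫⁻ x, f x ∂(stdGaussian (EuclideanSpace ℝ (Fin D))) =
      ∫⁻ v, f (WithLp.toLp 2 v) ∂(Measure.pi fun _ : Fin D => gaussianReal 0 1) := by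
  rw [← map_pi_eq_stdGaussian, lintegral_map hf (by fun_prop)]

/-- A layer maps the product of its logistic mixtures to the standard Gaussian. -/
theorem LayerParams.lintegral_exp_logGain_mul {D : ℕ} (θ : LayerParams D)
    {ψ : EuclideanSpace ℝ (Fin D) → ENNReal} (hψ : Measurable ψ) :
    ∫⁻ z, ENNReal.ofReal (Real.exp (θ.logGain z)) * ψ (θ.layer z)
        ∂(stdGaussian (EuclideanSpace ℝ (Fin D))) =
      ∫⁻ z, ψ z ∂(stdGaussian (EuclideanSpace ℝ (Fin D))) := by
  have hr : ∀ i, Measurable fun t => ENNReal.ofReal (θ.densityRatio i t) := fun i =>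
    (θ.continuous_densityRatio i).measurable.ennreal_ofReal
  have hT : ∀ i, Measurable (θ.coordMap i) := fun i => (θ.continuous_coordMap i).measurable
  have hinst : ∀ i, SigmaFinite ((gaussianReal 0 1).withDensity
      fun t => ENNReal.ofReal (θ.densityRatio i t)) := fun i =>
    inferInstanceAs (SigmaFinite (θ.mixtureMeasure i))
  have hinst2 : ∀ i, SigmaFinite ((θ.mixtureMeasure i).map (θ.coordMap i)) := fun i => by
    rw [θ.map_coordMap_mixtureMeasure]; infer_instance
  have hpi := Measure.pi_map_pi (μ := θ.mixtureMeasure) (f := θ.coordMap)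
    fun i => (hT i).aemeasurable
  simp_rw [θ.map_coordMap_mixtureMeasure] at hpi
  have hTpi : Measurable fun (v : Fin D → ℝ) i => θ.coordMap i (v i) :=
    measurable_pi_lambda _ fun i => (hT i).comp (measurable_pi_apply i)
  have hψ' : Measurable fun v : Fin D → ℝ => ψ (WithLp.toLp 2 v) := hψ.comp (by fun_prop)
  have hm : Measurable fun z => ENNReal.ofReal (Real.exp (θ.logGain z)) * ψ (θ.layer z) :=
    (θ.continuous_logGain.rexp.measurable.ennreal_ofReal).mul
      (hψ.comp θ.continuous_layer.measurable)
  have hd : Measure.pi θ.mixtureMeasure = (Measure.pi fun _ : Fin D => gaussianReal 0 1).withDensity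
      fun x => ∏ i, ENNReal.ofReal (θ.densityRatio i (x i)) :=
    pi_withDensity (fun _ : Fin D => gaussianReal 0 1) hr
  have hprod : Measurable fun x : Fin D → ℝ => ∏ i, ENNReal.ofReal (θ.densityRatio i (x i)) :=
    Finset.univ.measurable_fun_prod fun i _ => (hr i).comp (measurable_pi_apply i)
  have hψT : Measurable fun v : Fin D → ℝ =>
      ψ (WithLp.toLp 2 fun i => θ.coordMap i (v i)) := hψ'.comp hTpi
  rw [lintegral_stdGaussian hm]
  conv_rhs => rw [lintegral_stdGaussian hψ, ← hpi, lintegral_map hψ' hTpi, hd,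
    lintegral_withDensity_eq_lintegral_mul _ hprod hψT]
  refine lintegral_congr fun v => ?_
  rw [Pi.mul_apply, exp_logGain, ENNReal.ofReal_prod_of_nonneg
    fun i _ => (θ.densityRatio_pos i _).le]
  rfl

/-! ### Rotations -/

section Rotation

variable {D : ℕ} (R : Matrix.specialOrthogonalGroup (Fin D) ℝ)

lemma norm_rotate (x : EuclideanSpace ℝ (Fin D)) : ‖rotate R x‖ = ‖x‖ := by
  have hR := (Matrix.mem_orthogonalGroup_iff' _ _).1
    (Matrix.mem_specialOrthogonalGroup_iff.1 R.2).1
  rw [← sq_eq_sq₀ (norm_nonneg _) (norm_nonneg _), EuclideanSpace.real_norm_sq_eq,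
    EuclideanSpace.real_norm_sq_eq]
  have h : ∀ y : EuclideanSpace ℝ (Fin D), ∑ i, y i ^ 2 = y.ofLp ⬝ᵥ y.ofLp := fun y => by
    simp [dotProduct, sq]
  rw [h, h]
  simp only [rotate]
  rw [Matrix.dotProduct_mulVec, Matrix.vecMul_mulVec, hR, Matrix.vecMul_one]

/-- A rotation as a linear isometry. -/
def rotateIsometry : EuclideanSpace ℝ (Fin D) →ₗᵢ[ℝ] EuclideanSpace ℝ (Fin D) where
  toFun := rotate R
  map_add' x y := by ext i; simp [rotate, Matrix.mulVec_add]
  map_smul' c x := by ext i; simp [rotate, Matrix.mulVec_smul]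
  norm_map' := norm_rotate R

lemma continuous_rotate : Continuous (rotate R) := (rotateIsometry R).continuous

lemma measurePreserving_rotate :
    MeasurePreserving (rotate R) (stdGaussian (EuclideanSpace ℝ (Fin D)))
      (stdGaussian (EuclideanSpace ℝ (Fin D))) :=
  ⟨(continuous_rotate R).measurable,
    stdGaussian_map ((rotateIsometry R).toLinearIsometryEquiv rfl)⟩

lemma of_orthonormalBasis_mem_orthogonalGroup
    (b : OrthonormalBasis (Fin D) ℝ (EuclideanSpace ℝ (Fin D))) :
    (Matrix.of fun j k => b j k) ∈ Matrix.orthogonalGroup (Fin D) ℝ := by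
  rw [Matrix.mem_orthogonalGroup_iff]
  ext j k
  rw [Matrix.mul_apply, Matrix.one_apply, ← orthonormal_iff_ite.1 b.orthonormal j k,
    PiLp.inner_apply]
  exact Finset.sum_congr rfl fun l _ => mul_comm _ _

lemma diagonal_update_neg_one_mem_orthogonalGroup (i : Fin D) :
    (Matrix.diagonal (Function.update 1 i (-1)) : Matrix (Fin D) (Fin D) ℝ) ∈
      Matrix.orthogonalGroup (Fin D) ℝ := by
  rw [Matrix.mem_orthogonalGroup_iff, Matrix.diagonal_transpose, Matrix.diagonal_mul_diagonal,
    ← Matrix.diagonal_one]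
  congr 1
  ext j
  by_cases hj : j = i <;> simp [hj]

/-- Complete `t / ‖t‖`, placed as row `i`, to an orthonormal basis. If the determinant is −1, negate
that row; the free sign of `ξ` absorbs this, even for `D = 1`. The Gaussian characteristic function
sees only `ξ ^ 2`. -/
lemma exists_rotate_apply_eq_inner (i : Fin D) (t : EuclideanSpace ℝ (Fin D)) :
    ∃ (R : Matrix.specialOrthogonalGroup (Fin D) ℝ) (ξ : ℝ), ξ ^ 2 = ‖t‖ ^ 2 ∧
      ∀ x, ξ * rotate R x i = inner ℝ x t := by
  rcases eq_or_ne t 0 with rfl | ht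
  · exact ⟨1, 0, by rw [norm_zero], fun x => by rw [zero_mul, inner_zero_right]⟩
  have hu : ‖‖t‖⁻¹ • t‖ = 1 := norm_smul_inv_norm ht
  have hv : Orthonormal ℝ (({i} : Set (Fin D)).domRestrict fun _ : Fin D => ‖t‖⁻¹ • t) :=
    ⟨fun _ => hu, fun j k h => absurd (Subsingleton.elim j k) h⟩
  have hcard : Module.finrank ℝ (EuclideanSpace ℝ (Fin D)) = Fintype.card (Fin D) :=
    finrank_euclideanSpace
  obtain ⟨b, hb⟩ := hv.exists_orthonormalBasis_extension_of_card_eq hcard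
  have hbi : b i = ‖t‖⁻¹ • t := hb i (Set.mem_singleton i)
  set O : Matrix (Fin D) (Fin D) ℝ := Matrix.of fun j k => b j k with hO
  have hOo : O ∈ Matrix.orthogonalGroup (Fin D) ℝ := of_orthonormalBasis_mem_orthogonalGroup b
  have hrow : ∀ x : EuclideanSpace ℝ (Fin D), ‖t‖ * Matrix.mulVec O x.ofLp i = inner ℝ x t := by
    intro x
    have h1 : Matrix.mulVec O x.ofLp i = inner ℝ x (b i) := by
      rw [PiLp.inner_apply]; rfl
    rw [h1, hbi, inner_smul_right, mul_inv_cancel_left₀ (norm_ne_zero_iff.2 ht)]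
  have hdet : O.det = 1 ∨ O.det = -1 := by
    have := congrArg Matrix.det ((Matrix.mem_orthogonalGroup_iff _ _).1 hOo)
    rw [Matrix.det_mul, Matrix.det_transpose, Matrix.det_one] at this
    exact mul_self_eq_one_iff.1 this
  rcases hdet with hdet | hdet
  · exact ⟨⟨O, Matrix.mem_specialOrthogonalGroup_iff.2 ⟨hOo, hdet⟩⟩, ‖t‖, rfl, hrow⟩
  · set d : Matrix (Fin D) (Fin D) ℝ := Matrix.diagonal (Function.update 1 i (-1)) with hd
    have hdd : (d * O).det = 1 := by
      rw [Matrix.det_mul, hd, Matrix.det_diagonal, Finset.prod_update_of_mem (Finset.mem_univ i),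
        hdet]
      simp
    refine ⟨⟨d * O, Matrix.mem_specialOrthogonalGroup_iff.2
      ⟨mul_mem (diagonal_update_neg_one_mem_orthogonalGroup i) hOo, hdd⟩⟩, -‖t‖,
      neg_sq _, fun x => ?_⟩
    rw [← hrow x]
    simp only [rotate, hd, ← Matrix.mulVec_mulVec, Matrix.mulVec_diagonal, Function.update_self]
    ring

end Rotation

/-! ### Greedy selection and the likelihood bound -/

section Selection

variable {D : ℕ}

/-- `F` pushes the measure with density `exp ∘ L` relative to the standard Gaussian forward to the
standard Gaussian. -/
structure IsGaussianTransport (L : EuclideanSpace ℝ (Fin D) → ℝ)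
    (F : EuclideanSpace ℝ (Fin D) → EuclideanSpace ℝ (Fin D)) : Prop where
  continuous_logDensity : Continuous L
  continuous_map : Continuous F
  lintegral_eq : ∀ ψ : EuclideanSpace ℝ (Fin D) → ENNReal, Measurable ψ →
    ∫⁻ x, ENNReal.ofReal (Real.exp (L x)) * ψ (F x) ∂(stdGaussian (EuclideanSpace ℝ (Fin D))) =
      ∫⁻ x, ψ x ∂(stdGaussian (EuclideanSpace ℝ (Fin D)))

lemma isGaussianTransport_id : IsGaussianTransport (D := D) (fun _ => 0) fun x => x where
  continuous_logDensity := continuous_const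
  continuous_map := continuous_id
  lintegral_eq ψ _ := by simp

/-- Densities multiply under composition: test the transport `F` against `exp (logGain z) * ψ (layer
z)` at the rotated point. -/
lemma IsGaussianTransport.step {L : EuclideanSpace ℝ (Fin D) → ℝ}
    {F : EuclideanSpace ℝ (Fin D) → EuclideanSpace ℝ (Fin D)} (h : IsGaussianTransport L F)
    (θ : LayerParams D) (R : Matrix.specialOrthogonalGroup (Fin D) ℝ) :
    IsGaussianTransport (fun x => L x + θ.logGain (rotate R (F x)))
      (fun x => θ.layer (rotate R (F x))) where
  continuous_logDensity := h.continuous_logDensity.add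
    (θ.continuous_logGain.comp ((continuous_rotate R).comp h.continuous_map))
  continuous_map := θ.continuous_layer.comp ((continuous_rotate R).comp h.continuous_map)
  lintegral_eq ψ hψ := by
    have hm : Measurable fun z => ENNReal.ofReal (Real.exp (θ.logGain z)) * ψ (θ.layer z) :=
      (θ.continuous_logGain.rexp.measurable.ennreal_ofReal).mul
        (hψ.comp θ.continuous_layer.measurable)
    have h1 := h.lintegral_eq _ (hm.comp (continuous_rotate R).measurable)
    rw [← θ.lintegral_exp_logGain_mul hψ, ← (measurePreserving_rotate R).lintegral_comp hm]
    refine Eq.trans (lintegral_congr fun x => ?_) h1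
    rw [Real.exp_add, ENNReal.ofReal_mul (Real.exp_pos _).le, mul_assoc]
    rfl

variable {Q : Measure (EuclideanSpace ℝ (Fin D))}

variable (Q) in
/-- The mean logarithmic density gained by composing `F` with a rotation and a layer. -/
def meanGain (F : EuclideanSpace ℝ (Fin D) → EuclideanSpace ℝ (Fin D))
    (b : LayerParams D × Matrix.specialOrthogonalGroup (Fin D) ℝ) : ℝ :=
  ∫ x, b.1.logGain (rotate b.2 (F x)) ∂Q

instance : Nonempty (LayerParams D) :=
  ⟨⟨fun _ => 1, fun _ => one_pos, fun _ _ => 0, fun _ _ => 1, fun _ _ => one_pos⟩⟩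

variable (Q) in
/-- A layer and a rotation whose mean gain is maximal up to `η`, whenever such a pair exists. -/
def nearOptimal (F : EuclideanSpace ℝ (Fin D) → EuclideanSpace ℝ (Fin D)) (η : ℝ) :
    LayerParams D × Matrix.specialOrthogonalGroup (Fin D) ℝ :=
  Classical.epsilon fun a => ∀ b, meanGain Q F b ≤ meanGain Q F a + η

lemma meanGain_le_nearOptimal {F : EuclideanSpace ℝ (Fin D) → EuclideanSpace ℝ (Fin D)}
    (hF : BddAbove (Set.range (meanGain Q F))) {η : ℝ} (hη : 0 < η)
    (b : LayerParams D × Matrix.specialOrthogonalGroup (Fin D) ℝ) :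
    meanGain Q F b ≤ meanGain Q F (nearOptimal Q F η) + η := by
  have hex : ∃ a, ∀ b, meanGain Q F b ≤ meanGain Q F a + η := by
    obtain ⟨a, ha⟩ := exists_lt_of_lt_ciSup
      (show (⨆ b, meanGain Q F b) - η < ⨆ b, meanGain Q F b by linarith)
    exact ⟨a, fun b => by linarith [le_ciSup hF b]⟩
  exact Classical.epsilon_spec hex b

variable (Q) in
/-- The greedy flow, each of whose steps nearly maximizes the mean gain. -/
def greedyFlow : ℕ → EuclideanSpace ℝ (Fin D) → EuclideanSpace ℝ (Fin D)
  | 0, x => x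
  | k + 1, x => (nearOptimal Q (greedyFlow k) ((1 / 2) ^ k)).1.layer
      (rotate (nearOptimal Q (greedyFlow k) ((1 / 2) ^ k)).2 (greedyFlow k x))

variable (Q) in
/-- The layer and the rotation of step `k` of the greedy flow. -/
def greedyParams (k : ℕ) : LayerParams D × Matrix.specialOrthogonalGroup (Fin D) ℝ :=
  nearOptimal Q (greedyFlow Q k) ((1 / 2) ^ k)

lemma flow_greedyParams (k : ℕ) :
    flow (fun j => (greedyParams Q j).1) (fun j => (greedyParams Q j).2) k = greedyFlow Q k := by
  induction k with
  | zero => rfl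
  | succ k ih =>
    funext x
    rw [flow, ih]
    rfl

variable [IsProbabilityMeasure Q] {S : Set (EuclideanSpace ℝ (Fin D))}

lemma integrable_of_continuous_of_compact (hS : IsCompact S) (hQS : ∀ᵐ x ∂Q, x ∈ S)
    {g : EuclideanSpace ℝ (Fin D) → ℝ} (hg : Continuous g) : Integrable g Q := by
  have : IntegrableOn g S Q := hg.continuousOn.integrableOn_compact hS
  rwa [IntegrableOn, Measure.restrict_eq_self_of_ae_mem hQS] at this

/-- From `L ≤ exp L`, whose Gaussian integral is 1. The bound does not depend on the flow, so it
caps the total gain. -/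
lemma IsGaussianTransport.integral_le {L : EuclideanSpace ℝ (Fin D) → ℝ}
    {F : EuclideanSpace ℝ (Fin D) → EuclideanSpace ℝ (Fin D)} (h : IsGaussianTransport L F)
    (hS : IsCompact S) (hQS : ∀ᵐ x ∂Q, x ∈ S) {M : ENNReal} (hM : M ≠ ⊤)
    (hQ : Q ≤ M • stdGaussian (EuclideanSpace ℝ (Fin D))) : ∫ x, L x ∂Q ≤ M.toReal := by
  have hL := h.continuous_logDensity
  calc ∫ x, L x ∂Q ≤ ∫ x, Real.exp (L x) ∂Q := by
        refine integral_mono (integrable_of_continuous_of_compact hS hQS hL)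
          (integrable_of_continuous_of_compact hS hQS hL.rexp) fun x => ?_
        have := Real.add_one_le_exp (L x)
        dsimp only
        linarith
    _ = (∫⁻ x, ENNReal.ofReal (Real.exp (L x)) ∂Q).toReal :=
        integral_eq_lintegral_of_nonneg_ae (ae_of_all _ fun x => (Real.exp_pos _).le)
          hL.rexp.aestronglyMeasurable
    _ ≤ M.toReal := by
        refine ENNReal.toReal_mono hM ((lintegral_mono' hQ le_rfl).trans ?_)
        rw [lintegral_smul_measure]
        have h1 := h.lintegral_eq (fun _ => 1) measurable_const
        simp only [mul_one, lintegral_const, measure_univ] at h1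
        rw [h1, smul_eq_mul, mul_one]

lemma IsGaussianTransport.integral_add_logGain {L : EuclideanSpace ℝ (Fin D) → ℝ}
    {F : EuclideanSpace ℝ (Fin D) → EuclideanSpace ℝ (Fin D)} (h : IsGaussianTransport L F)
    (hS : IsCompact S) (hQS : ∀ᵐ x ∂Q, x ∈ S)
    (b : LayerParams D × Matrix.specialOrthogonalGroup (Fin D) ℝ) :
    ∫ x, (L x + b.1.logGain (rotate b.2 (F x))) ∂Q = ∫ x, L x ∂Q + meanGain Q F b := by
  have h2 : Continuous fun x => b.1.logGain (rotate b.2 (F x)) :=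
    b.1.continuous_logGain.comp ((continuous_rotate b.2).comp h.continuous_map)
  rw [integral_add (integrable_of_continuous_of_compact hS hQS h.continuous_logDensity)
    (integrable_of_continuous_of_compact hS hQS h2), meanGain]

lemma exists_isGaussianTransport_greedyFlow (hS : IsCompact S) (hQS : ∀ᵐ x ∂Q, x ∈ S) (k : ℕ) :
    ∃ L, IsGaussianTransport L (greedyFlow Q k) ∧
      ∫ x, L x ∂Q = ∑ j ∈ Finset.range k, meanGain Q (greedyFlow Q j) (greedyParams Q j) := by
  induction k with
  | zero => exact ⟨_, isGaussianTransport_id, by simp⟩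
  | succ k ih =>
    obtain ⟨L, hL, hI⟩ := ih
    refine ⟨_, hL.step (greedyParams Q k).1 (greedyParams Q k).2, ?_⟩
    rw [hL.integral_add_logGain hS hQS, hI, Finset.sum_range_succ]

/-- Layers can gain as much as any product of small mean-zero perturbations of the standard normal
density, up to an arbitrarily small loss. -/
lemma exists_le_logGain (h : Fin D → ℝ → ℝ) (hc : ∀ i, Continuous (h i))
    (hb : ∀ i x, |h i x| ≤ 1 / 2) (h0 : ∀ i, ∫ x, h i x ∂(gaussianReal 0 1) = 0)
    {η : ℝ} (hη : 0 < η) :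
    ∃ θ : LayerParams D, ∀ z, ∑ i, Real.log (1 + h i (z i)) - η ≤ θ.logGain z := by
  -- Each of the `D` coordinates loses at most `-log (1 - ε)`.
  obtain ⟨ε, hε0, hε1, hε⟩ : ∃ ε > 0, ε < 1 ∧ -η ≤ D * Real.log (1 - ε) := by
    have : Tendsto (fun ε : ℝ => D * Real.log (1 - ε)) (nhdsWithin 0 (Set.Ioi 0)) (nhds 0) := by
      have hcont : ContinuousAt (fun ε : ℝ => D * Real.log (1 - ε)) 0 := by
        refine continuousAt_const.mul (ContinuousAt.log (by fun_prop) (by norm_num))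
      have h1 := hcont.tendsto
      simp only [sub_zero, Real.log_one, mul_zero] at h1
      exact h1.mono_left nhdsWithin_le_nhds
    obtain ⟨ε, h1, h2⟩ := ((this.eventually_const_lt (show -η < 0 by linarith)).and
      (Ioo_mem_nhdsGT (zero_lt_one))).exists
    exact ⟨ε, h2.1, h2.2, h1.le⟩
  choose N m s hN hs hd using fun i =>
    dominatedByMixture_perturbation (hc i) (hb i) (h0 i) hε0 hε1
  refine ⟨⟨N, hN, m, s, hs⟩, fun z => ?_⟩
  have hle : ∀ i, Real.log (1 + h i (z i)) + Real.log (1 - ε) ≤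
      Real.log (LayerParams.densityRatio ⟨N, hN, m, s, hs⟩ i (z i)) := by
    intro i
    have h1 : 0 < 1 + h i (z i) := by linarith [(abs_le.1 (hb i (z i))).1]
    have h2 : 0 < 1 - ε := by linarith
    rw [← Real.log_mul h1.ne' h2.ne']
    refine Real.log_le_log (mul_pos h1 h2) ?_
    rw [LayerParams.densityRatio, le_div_iff₀ (stdNormalPDF_pos _)]
    refine le_trans (le_of_eq ?_) (hd i (z i))
    ring
  calc _ ≤ ∑ i, (Real.log (1 + h i (z i)) + Real.log (1 - ε)) := by
        rw [Finset.sum_add_distrib, Finset.sum_const, Finset.card_univ, Fintype.card_fin,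
          nsmul_eq_mul]
        linarith
    _ ≤ _ := Finset.sum_le_sum fun i _ => hle i

/-- The best possible gains along the greedy flow tend to zero. -/
theorem exists_tendsto_zero_meanGain_le (hS : IsCompact S) (hQS : ∀ᵐ x ∂Q, x ∈ S) {M : ENNReal}
    (hM : M ≠ ⊤) (hQ : Q ≤ M • stdGaussian (EuclideanSpace ℝ (Fin D))) :
    ∃ c : ℕ → ℝ, Tendsto c atTop (nhds 0) ∧ ∀ k b, meanGain Q (greedyFlow Q k) b ≤ c k := by
  set a : ℕ → ℝ := fun k => meanGain Q (greedyFlow Q k) (greedyParams Q k) with ha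
  choose L hL hI using exists_isGaussianTransport_greedyFlow (Q := Q) hS hQS
  -- The flow extended by any one step is still a transport, so its mean log-density is at most `M`.
  have hbdd : ∀ k, BddAbove (Set.range (meanGain Q (greedyFlow Q k))) := by
    intro k
    refine ⟨M.toReal - ∫ x, L k x ∂Q, ?_⟩
    rintro _ ⟨b, rfl⟩
    have h1 := ((hL k).step b.1 b.2).integral_le hS hQS hM hQ
    rw [(hL k).integral_add_logGain hS hQS] at h1
    linarith
  have hopt : ∀ k b, meanGain Q (greedyFlow Q k) b ≤ a k + (1 / 2) ^ k := fun k b =>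
    meanGain_le_nearOptimal (hbdd k) (by positivity) b
  -- The unperturbed choice `h = 0` gives layers losing arbitrarily little, so the best gain is
  -- never negative.
  have hnonneg : ∀ k, 0 ≤ a k + (1 / 2) ^ k := by
    intro k
    refine le_of_forall_pos_le_add fun η hη => ?_
    obtain ⟨θ, hθ⟩ := exists_le_logGain (D := D) (fun _ _ => 0) (fun _ => continuous_const)
      (by norm_num) (by simp) hη
    have h1 : -η ≤ meanGain Q (greedyFlow Q k) (θ, 1) := by
      have h2 : ∫ _, -η ∂Q ≤ meanGain Q (greedyFlow Q k) (θ, 1) := by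
        refine integral_mono (integrable_const _) (integrable_of_continuous_of_compact hS hQS
          (θ.continuous_logGain.comp ((continuous_rotate _).comp (hL k).continuous_map)))
          fun x => ?_
        simpa using hθ (rotate 1 (greedyFlow Q k x))
      simpa using h2
    linarith [hopt k (θ, 1)]
  refine ⟨fun k => a k + (1 / 2) ^ k, ?_, hopt⟩
  have hgeo : ∀ n, ∑ j ∈ Finset.range n, ((1 : ℝ) / 2) ^ j ≤ 2 := fun n =>
    sum_geometric_two_le n
  refine (summable_of_sum_range_le (c := M.toReal + 2) hnonneg fun n => ?_).tendsto_atTop_zero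
  rw [Finset.sum_add_distrib]
  have := (hL n).integral_le hS hQS hM hQ
  rw [hI n] at this
  exact add_le_add this (hgeo n)

end Selection

/-! ### From vanishing gain to convergence of characteristic functions -/

section Convergence

variable {D : ℕ} {Q : Measure (EuclideanSpace ℝ (Fin D))} [IsProbabilityMeasure Q]
  {F : ℕ → EuclideanSpace ℝ (Fin D) → EuclideanSpace ℝ (Fin D)} {c : ℕ → ℝ}

lemma sub_two_mul_sq_le_log_one_add {y : ℝ} (hy : |y| ≤ 1 / 2) : y - 2 * y ^ 2 ≤ Real.log (1 + y) := by
  have h := abs_le.1 hy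
  have h1 : 0 < 1 + y := by linarith
  have h2 := Real.one_sub_inv_le_log_of_pos h1
  refine le_trans ?_ h2
  rw [le_sub_iff_add_le, ← le_sub_iff_add_le', inv_le_iff_one_le_mul₀ h1]
  nlinarith [mul_nonneg (sq_nonneg y) (show 0 ≤ y + 1 / 2 by linarith)]

/-- The competing layer perturbs only coordinate `i`, by the relative density `1 + t * h`, and does
not depend on `k`. Its gain is at most `c k`, while its part linear in `t` is the integral to be
bounded. -/
lemma eventually_integral_le_of_meanGain_le (hF : ∀ k, Continuous (F k))
    (hgi : ∀ g : EuclideanSpace ℝ (Fin D) → ℝ, Continuous g → Integrable g Q)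
    (hc0 : Tendsto c atTop (nhds 0)) (hc : ∀ k b, meanGain Q (F k) b ≤ c k)
    (R : Matrix.specialOrthogonalGroup (Fin D) ℝ) (i : Fin D) {h : ℝ → ℝ} (hh : Continuous h)
    (hb : ∀ x, |h x| ≤ 2) (h0 : ∫ x, h x ∂(gaussianReal 0 1) = 0) {ε : ℝ} (hε : 0 < ε) :
    ∀ᶠ k in atTop, ∫ x, h (rotate R (F k x) i) ∂Q ≤ ε := by
  -- `t ≤ 1/4` ensures `|t * h| ≤ 1/2`. The error budget `t * ε` is half for the quadratic term `2 *
  -- (t * h)² ≤ 8 * t²`, a quarter for the layer's loss and a quarter for `c k`.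
  obtain ⟨t, ht0, ht1, ht2⟩ : ∃ t > 0, t ≤ 1 / 4 ∧ 8 * t ≤ ε / 2 :=
    ⟨min (1 / 4) (ε / 16), by positivity, min_le_left _ _,
      by linarith [min_le_right (1 / 4) (ε / 16)]⟩
  have htb : ∀ x, |t * h x| ≤ 1 / 2 := fun x => by
    rw [abs_mul, abs_of_pos ht0]
    nlinarith [hb x, abs_nonneg (h x)]
  obtain ⟨θ, hθ⟩ := exists_le_logGain (fun j x => if j = i then t * h x else 0)
    (fun j => by split_ifs <;> fun_prop)
    (fun j x => by split_ifs; exacts [htb x, by norm_num])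
    (fun j => by split_ifs; exacts [by rw [integral_const_mul, h0, mul_zero], by simp])
    (show 0 < t * ε / 4 by positivity)
  filter_upwards [hc0.eventually_le_const (show 0 < t * ε / 4 by positivity)] with k hk
  have hrc : Continuous fun x => rotate R (F k x) i :=
    (PiLp.continuous_apply 2 _ i).comp ((continuous_rotate R).comp (hF k))
  have hpt : ∀ z : EuclideanSpace ℝ (Fin D), t * h (z i) - 8 * t ^ 2 - t * ε / 4 ≤
      θ.logGain z := by
    intro z
    refine le_trans ?_ (hθ z)
    rw [Finset.sum_eq_single i (fun j _ hj => by simp [hj]) (by simp), if_pos rfl]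
    have h1 := sub_two_mul_sq_le_log_one_add (htb (z i))
    have h2 : h (z i) ^ 2 ≤ 4 := by
      have := sq_le_sq' (by linarith [(abs_le.1 (hb (z i))).1]) (abs_le.1 (hb (z i))).2
      linarith
    nlinarith [sq_nonneg t]
  have hint : t * (∫ x, h (rotate R (F k x) i) ∂Q) - 8 * t ^ 2 - t * ε / 4 ≤ c k := by
    refine le_trans ?_ (hc k (θ, R))
    have hi : Integrable (fun x => t * h (rotate R (F k x) i)) Q :=
      hgi _ ((hh.comp hrc).const_mul t)
    have hi2 : Integrable (fun x => t * h (rotate R (F k x) i) - 8 * t ^ 2) Q :=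
      hi.sub (integrable_const _)
    calc _ = ∫ x, (t * h (rotate R (F k x) i) - 8 * t ^ 2 - t * ε / 4) ∂Q := by
          rw [integral_sub hi2 (integrable_const _),
            integral_sub hi (integrable_const _), integral_const_mul]
          simp
      _ ≤ _ := integral_mono (hi2.sub (integrable_const _))
          (hgi _ (θ.continuous_logGain.comp ((continuous_rotate R).comp (hF k))))
          fun x => hpt _
  have h3 : t * (∫ x, h (rotate R (F k x) i) ∂Q) ≤ t * ε := by nlinarith
  exact le_of_mul_le_mul_left h3 ht0

/-- If no rotation and layer gain much, the one-dimensional marginals are nearly standard normal. -/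
lemma tendsto_integral_of_meanGain_le (hF : ∀ k, Continuous (F k))
    (hgi : ∀ g : EuclideanSpace ℝ (Fin D) → ℝ, Continuous g → Integrable g Q)
    (hc0 : Tendsto c atTop (nhds 0)) (hc : ∀ k b, meanGain Q (F k) b ≤ c k)
    (R : Matrix.specialOrthogonalGroup (Fin D) ℝ) (i : Fin D) {h : ℝ → ℝ} (hh : Continuous h)
    (hb : ∀ x, |h x| ≤ 1) :
    Tendsto (fun k => ∫ x, h (rotate R (F k x) i) ∂Q) atTop
      (nhds (∫ x, h x ∂(gaussianReal 0 1))) := by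
  set m := ∫ x, h x ∂(gaussianReal 0 1) with hm
  have hhi : Integrable h (gaussianReal 0 1) :=
    Integrable.of_bound hh.aestronglyMeasurable 1 (ae_of_all _ hb)
  have hm1 : |m| ≤ 1 := by
    have := norm_integral_le_of_norm_le_const (μ := gaussianReal 0 1) (f := h)
      (ae_of_all _ hb)
    simpa using this
  have hb1 : ∀ x, |h x - m| ≤ 2 := fun x => (abs_sub _ _).trans (by linarith [hb x])
  have hb2 : ∀ x, |m - h x| ≤ 2 := fun x => by rw [abs_sub_comm]; exact hb1 x
  have hz1 : ∫ x, (h x - m) ∂(gaussianReal 0 1) = 0 := by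
    rw [integral_sub hhi (integrable_const _)]; simp [hm]
  have hz2 : ∫ x, (m - h x) ∂(gaussianReal 0 1) = 0 := by
    rw [integral_sub (integrable_const _) hhi]; simp [hm]
  rw [Metric.tendsto_nhds]
  intro ε hε
  -- The one-sided estimate for both signs of the centred function, each bounded by 2, yields a
  -- two-sided one.
  filter_upwards [eventually_integral_le_of_meanGain_le hF hgi hc0 hc R i
      (h := fun x => h x - m) (hh.sub continuous_const) hb1 hz1 (half_pos hε),
    eventually_integral_le_of_meanGain_le hF hgi hc0 hc R i
      (h := fun x => m - h x) (continuous_const.sub hh) hb2 hz2 (half_pos hε)] with k h1 h2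
  have hi : Integrable (fun x => h (rotate R (F k x) i)) Q :=
    hgi _ (hh.comp ((PiLp.continuous_apply 2 _ i).comp ((continuous_rotate R).comp (hF k))))
  rw [integral_sub hi (integrable_const _)] at h1
  rw [integral_sub (integrable_const _) hi] at h2
  simp only [integral_const, probReal_univ, one_smul] at h1 h2
  rw [Real.dist_eq, abs_lt]
  constructor <;> linarith

lemma integral_cexp_mul_I {Ω : Type*} [MeasurableSpace Ω] (P : Measure Ω) [IsProbabilityMeasure P]
    {g : Ω → ℝ} (hg : Measurable g) :
    ∫ x, Complex.exp (g x * Complex.I) ∂P =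
      (∫ x, Real.cos (g x) ∂P : ℝ) + (∫ x, Real.sin (g x) ∂P : ℝ) * Complex.I := by
  have hcos : Integrable (fun x => Real.cos (g x)) P :=
    Integrable.of_bound (Real.measurable_cos.comp hg).aestronglyMeasurable 1
      (ae_of_all _ fun x => Real.abs_cos_le_one _)
  have hsin : Integrable (fun x => Real.sin (g x)) P :=
    Integrable.of_bound (Real.measurable_sin.comp hg).aestronglyMeasurable 1
      (ae_of_all _ fun x => Real.abs_sin_le_one _)
  simp_rw [Complex.exp_mul_I, ← Complex.ofReal_cos, ← Complex.ofReal_sin]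
  rw [integral_add hcos.ofReal (hsin.ofReal.mul_const _), integral_mul_const,
    integral_complex_ofReal, integral_complex_ofReal]

/-- If no rotation and layer gain much, the characteristic functions are nearly Gaussian. -/
theorem tendsto_charFun_of_meanGain_le (hF : ∀ k, Continuous (F k))
    (hgi : ∀ g : EuclideanSpace ℝ (Fin D) → ℝ, Continuous g → Integrable g Q)
    (hc0 : Tendsto c atTop (nhds 0)) (hc : ∀ k b, meanGain Q (F k) b ≤ c k)
    (t : EuclideanSpace ℝ (Fin D)) :
    Tendsto (fun k => charFun (Q.map (F k)) t) atTop
      (nhds (charFun (stdGaussian (EuclideanSpace ℝ (Fin D))) t)) := by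
  -- For `D = 0` there is no coordinate to use, but only `t = 0` occurs and both sides are 1.
  rcases isEmpty_or_nonempty (Fin D) with hD | ⟨⟨i⟩⟩
  · have ht : t = 0 := Subsingleton.elim _ _
    subst ht
    have : ∀ k, IsProbabilityMeasure (Q.map (F k)) := fun k =>
      Measure.isProbabilityMeasure_map (hF k).aemeasurable
    simp
  obtain ⟨R, ξ, hξ, hR⟩ := exists_rotate_apply_eq_inner i t
  have hk : ∀ k, charFun (Q.map (F k)) t =
      (∫ x, Real.cos (ξ * rotate R (F k x) i) ∂Q : ℝ) +
        (∫ x, Real.sin (ξ * rotate R (F k x) i) ∂Q : ℝ) * Complex.I := by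
    intro k
    rw [charFun_apply, integral_map (hF k).aemeasurable (by fun_prop), ← integral_cexp_mul_I]
    · simp_rw [hR]
    · exact (((PiLp.continuous_apply 2 _ i).comp
        ((continuous_rotate R).comp (hF k))).const_mul ξ).measurable
  have hlim : charFun (stdGaussian (EuclideanSpace ℝ (Fin D))) t =
      (∫ x, Real.cos (ξ * x) ∂(gaussianReal 0 1) : ℝ) +
        (∫ x, Real.sin (ξ * x) ∂(gaussianReal 0 1) : ℝ) * Complex.I := by
    rw [← integral_cexp_mul_I _ (by fun_prop), charFun_stdGaussian, ← Complex.ofReal_pow, ← hξ]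
    have := charFun_gaussianReal (μ := 0) (v := 1) ξ
    rw [charFun_apply_real] at this
    push_cast at this ⊢
    rw [this]
    congr 1
    simp
    ring
  simp_rw [hk, hlim]
  refine Tendsto.add ?_ (Tendsto.mul_const _ ?_)
  · exact (Complex.continuous_ofReal.tendsto _).comp (tendsto_integral_of_meanGain_le hF hgi hc0 hc
      R i (h := fun y => Real.cos (ξ * y)) (by fun_prop) fun x => Real.abs_cos_le_one _)
  · exact (Complex.continuous_ofReal.tendsto _).comp (tendsto_integral_of_meanGain_le hF hgi hc0 hc
      R i (h := fun y => Real.sin (ξ * y)) (by fun_prop) fun x => Real.abs_sin_le_one _)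

end Convergence

/-! ### Domination of the data law by the Gaussian, and the main theorem -/

/-- Lebesgue measure is dominated by the standard Gaussian on compact sets. -/
lemma exists_volume_restrict_le_smul_stdGaussian {D : ℕ} {S : Set (EuclideanSpace ℝ (Fin D))}
    (hS : IsCompact S) : ∃ C : ENNReal, C ≠ ⊤ ∧
      (volume : Measure (EuclideanSpace ℝ (Fin D))).restrict S ≤
        C • stdGaussian (EuclideanSpace ℝ (Fin D)) := by
  have hci : Continuous fun t : ℝ => (stdNormalPDF t)⁻¹ :=
    continuous_stdNormalPDF.inv₀ fun t => (stdNormalPDF_pos t).ne'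
  -- Lebesgue measure has density 1/φ relative to the Gaussian; the product of these densities is
  -- continuous, hence bounded on `S`.
  have hvol : (volume : Measure ℝ) =
      (gaussianReal 0 1).withDensity fun t => ENNReal.ofReal (stdNormalPDF t)⁻¹ := by
    rw [gaussianReal_eq_withDensity, ← withDensity_mul]
    · conv_lhs => rw [← withDensity_one (μ := (volume : Measure ℝ))]
      congr 1
      ext t
      rw [Pi.mul_apply, ← ENNReal.ofReal_mul (stdNormalPDF_pos t).le,
        mul_inv_cancel₀ (stdNormalPDF_pos t).ne', ENNReal.ofReal_one, Pi.one_apply]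
    · exact continuous_stdNormalPDF.measurable.ennreal_ofReal
    · exact hci.measurable.ennreal_ofReal
  have hsf : SigmaFinite
      ((gaussianReal 0 1).withDensity fun t => ENNReal.ofReal (stdNormalPDF t)⁻¹) := by
    rw [← hvol]; infer_instance
  have hpi : (volume : Measure (Fin D → ℝ)) = (Measure.pi fun _ : Fin D =>
      gaussianReal 0 1).withDensity fun v => ∏ i, ENNReal.ofReal (stdNormalPDF (v i))⁻¹ := by
    rw [← pi_withDensity (fun _ : Fin D => gaussianReal 0 1)
      (f := fun _ t => ENNReal.ofReal (stdNormalPDF t)⁻¹)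
      fun _ => hci.measurable.ennreal_ofReal, ← hvol]
    rfl
  have hw : Continuous fun x : EuclideanSpace ℝ (Fin D) => ∏ i, (stdNormalPDF (x i))⁻¹ :=
    continuous_finsetProd _ fun i _ => hci.comp (PiLp.continuous_apply 2 _ i)
  obtain ⟨C, hC⟩ := hS.bddAbove_image hw.continuousOn
  refine ⟨ENNReal.ofReal C, ENNReal.ofReal_ne_top, Measure.le_iff.2 fun A hA => ?_⟩
  have hB : MeasurableSet (A ∩ S) := hA.inter hS.measurableSet
  rw [Measure.restrict_apply hA, Measure.smul_apply, smul_eq_mul]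
  refine le_trans ?_ (mul_le_mul_right (measure_mono (Set.inter_subset_left : A ∩ S ⊆ A)) _)
  have hto : Measurable (WithLp.toLp 2 : (Fin D → ℝ) → EuclideanSpace ℝ (Fin D)) := by fun_prop
  rw [← (PiLp.volume_preserving_toLp (Fin D)).measure_preimage hB.nullMeasurableSet,
    ← map_pi_eq_stdGaussian, Measure.map_apply hto hB, hpi, withDensity_apply _ (hto hB),
    ← setLIntegral_const]
  refine setLIntegral_mono measurable_const fun v hv => ?_
  rw [← ENNReal.ofReal_prod_of_nonneg fun i _ => (inv_pos.2 (stdNormalPDF_pos _)).le]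
  exact ENNReal.ofReal_le_ofReal (hC ⟨WithLp.toLp 2 v, hv.2, rfl⟩)

lemma exists_withDensity_le_smul_stdGaussian {D : ℕ} {S : Set (EuclideanSpace ℝ (Fin D))}
    (hS : IsCompact S) {p : EuclideanSpace ℝ (Fin D) → ℝ} (hp_cont : ContinuousOn p S)
    (hp_supp : ∀ x, x ∉ S → p x = 0) : ∃ M : ENNReal, M ≠ ⊤ ∧
      (volume.withDensity fun x => ENNReal.ofReal (p x)) ≤
        M • stdGaussian (EuclideanSpace ℝ (Fin D)) := by
  obtain ⟨C, hC, hle⟩ := exists_volume_restrict_le_smul_stdGaussian hS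
  obtain ⟨B, hB⟩ := hS.bddAbove_image hp_cont
  refine ⟨ENNReal.ofReal B * C, ENNReal.mul_ne_top ENNReal.ofReal_ne_top hC, ?_⟩
  have h1 : (volume.withDensity fun x => ENNReal.ofReal (p x)) ≤
      ENNReal.ofReal B • (volume : Measure (EuclideanSpace ℝ (Fin D))).restrict S := by
    rw [← withDensity_const, ← withDensity_indicator hS.measurableSet]
    refine withDensity_mono (ae_of_all _ fun x => ?_)
    by_cases hx : x ∈ S
    · rw [Set.indicator_of_mem hx]
      exact ENNReal.ofReal_le_ofReal (hB ⟨x, hx, rfl⟩)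
    · simp [hp_supp x hx]
  refine h1.trans ?_
  rw [mul_smul]
  gcongr

end GaussianizationFlow

end

theorem theorem1 (D : ℕ) (S : Set (EuclideanSpace ℝ (Fin D))) (hS : IsCompact S)
    (p : EuclideanSpace ℝ (Fin D) → ℝ) (hp_cont : ContinuousOn p S)
    (hp_supp : ∀ x, x ∉ S → p x = 0) (hp_int : ∫ x, p x = 1)
    (δ : ℝ) (hδ : 0 < δ) (hp_lower : ∀ x ∈ S, δ ≤ p x) :
    ∃ (θ : ℕ → GaussianizationFlow.LayerParams D)
      (R : ℕ → Matrix.specialOrthogonalGroup (Fin D) ℝ),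
      ∀ (Ω : Type*) [MeasurableSpace Ω] (P : Measure Ω) [IsProbabilityMeasure P]
        (X : Ω → EuclideanSpace ℝ (Fin D)),
        HasLaw X (volume.withDensity fun x => ENNReal.ofReal (p x)) P →
        TendstoInDistribution (fun (k : ℕ) (ω : Ω) => GaussianizationFlow.flow θ R k (X ω)) atTop
          (id : EuclideanSpace ℝ (Fin D) → EuclideanSpace ℝ (Fin D)) (fun _ => P)
          (stdGaussian (EuclideanSpace ℝ (Fin D))) := by
  set Q : Measure (EuclideanSpace ℝ (Fin D)) :=
    volume.withDensity fun x => ENNReal.ofReal (p x) with hQdef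
  have hp0 : ∀ x, 0 ≤ p x := fun x => by
    by_cases hx : x ∈ S
    · exact hδ.le.trans (hp_lower x hx)
    · exact (hp_supp x hx).ge
  have hQ1 : IsProbabilityMeasure Q := ⟨by
    rw [hQdef, withDensity_apply _ MeasurableSet.univ, Measure.restrict_univ,
      ← ofReal_integral_eq_lintegral_ofReal (integrable_of_integral_eq_one hp_int)
        (ae_of_all _ hp0), hp_int, ENNReal.ofReal_one]⟩
  have hQS : ∀ᵐ x ∂Q, x ∈ S := by
    rw [ae_iff, hQdef]
    have hm : MeasurableSet {x | x ∉ S} := hS.measurableSet.compl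
    rw [withDensity_apply _ hm, setLIntegral_congr_fun hm (g := fun _ => 0)
      fun x hx => by simp [hp_supp x hx], lintegral_zero]
  obtain ⟨M, hM, hQM⟩ := GaussianizationFlow.exists_withDensity_le_smul_stdGaussian hS hp_cont hp_supp
  obtain ⟨c, hc0, hc⟩ := GaussianizationFlow.exists_tendsto_zero_meanGain_le (Q := Q) hS hQS hM hQM
  have hcont : ∀ k, Continuous (GaussianizationFlow.greedyFlow Q k) := fun k => by
    obtain ⟨L, hL, -⟩ := GaussianizationFlow.exists_isGaussianTransport_greedyFlow (Q := Q) hS hQS k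
    exact hL.continuous_map
  have hchar := GaussianizationFlow.tendsto_charFun_of_meanGain_le hcont
    (fun g hg => GaussianizationFlow.integrable_of_continuous_of_compact hS hQS hg) hc0 hc
  -- The parameters are built from `Q` alone, before any random vector is introduced.
  refine ⟨fun k => (GaussianizationFlow.greedyParams Q k).1, fun k => (GaussianizationFlow.greedyParams Q k).2, ?_⟩
  intro Ω _ P _ X hX
  have hmeas : ∀ k, AEMeasurable (fun ω => GaussianizationFlow.flow (fun k => (GaussianizationFlow.greedyParams Q k).1)
      (fun k => (GaussianizationFlow.greedyParams Q k).2) k (X ω)) P := fun k => by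
    rw [GaussianizationFlow.flow_greedyParams]
    exact (hcont k).measurable.comp_aemeasurable hX.aemeasurable
  refine ⟨hmeas, aemeasurable_id, ProbabilityMeasure.tendsto_of_tendsto_charFun fun t => ?_⟩
  have hlaw : ∀ k, P.map (fun ω => GaussianizationFlow.flow (fun k => (GaussianizationFlow.greedyParams Q k).1)
      (fun k => (GaussianizationFlow.greedyParams Q k).2) k (X ω)) = Q.map (GaussianizationFlow.greedyFlow Q k) := fun k => by
    have hcomp := AEMeasurable.map_map_of_aemeasurable (hcont k).aemeasurable hX.aemeasurable
    rw [hX.map_eq] at hcomp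
    rw [GaussianizationFlow.flow_greedyParams, hcomp]
    rfl
  simp only [ProbabilityMeasure.coe_mk, hlaw, Measure.map_id]
  exact hchar t
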